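/- Let $R$ be a commutative ring with identity and $S\subseteq R$ a multiplicative subset (which may contain zero-divisors), with localization $R_S$. For an $R$-module $M$ write $M_S=M\otimes_R R_S$ and $M/sM=M\otimes_R R/sR$. For a class $\mathcal C$ of $R$-modules let ${}^{\perp}\mathcal C$ be the class of $R$-modules $M$ with $\mathrm{Ext}^1_R(M,C)=0$ for all $C\in\mathcal C$. An $R$-module $C$ is $S$-weakly cotorsion if $\mathrm{Ext}^1_R(R_S,C)=0$; write $S\text{-}\mathrm{WC}$ for the class of these, and let $S\text{-}\mathrm{SF}={}^{\perp}(S\text{-}\mathrm{WC})$ be the class of $S$-strongly flat modules. A short exact sequence $\eta$ of $R$-modules is $S$-pure exact if it is pure exact, $\eta\otimes_R R_S$ is split exact as a sequence of $R_S$-modules, and for every $s\in S$ the sequence $\eta\otimes_R R/sR$ is split exact as a sequence of $R/sR$-modules. An $R$-module $E$ is $S$-pure injective if it is injective with respect to all $S$-pure exact sequences, i.e. for every $S$-pure exact sequence $0\to N\to M\to L\to 0$ every homomorphism $N\to E$ extends to $M$; write $S\text{-}\mathrm{PInj}$ for the class of these. Assume that $(R,S)$ satisfies the condition $(\mathbb{OC})$: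 the projective dimension of $R_S$ as an $R$-module is at most $1$, and a flat $R$-module $F$ is $S$-strongly flat if and only if $F_S$ is a projective $R_S$-module and $F/sF$ is a projective $R/sR$-module for every $s\in S$. Then $$S\text{-}\mathrm{SF}={}^{\perp}(S\text{-}\mathrm{PInj}).$$ -/

import Mathlib

open CategoryTheory TensorProduct

universe u

/-- `0 → N → M → L → 0`, with maps `f` and `g`, is a short exact sequence. -/
structure IsShortExactSeq {R : Type u} [CommRing R] {N M L : Type u}
    [AddCommGroup N] [Module R N] [AddCommGroup M] [Module R M] [AddCommGroup L] [Module R L]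
    (f : N →ₗ[R] M) (g : M →ₗ[R] L) : Prop where
  injective : Function.Injective f
  exact : Function.Exact f g
  surjective : Function.Surjective g

/-- A short exact sequence of `R`-modules that splits by an `R`-linear section. -/
structure IsSplitExactSeq {R : Type u} [CommRing R] {N M L : Type u}
    [AddCommGroup N] [Module R N] [AddCommGroup M] [Module R M] [AddCommGroup L] [Module R L]
    (f : N →ₗ[R] M) (g : M →ₗ[R] L) : Prop extends IsShortExactSeq f g where
  split : ∃ σ : L →ₗ[R] M, g ∘ₗ σ = LinearMap.id

/-- A short exact sequence that stays short exact after tensoring with any `R`-module. -/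
structure IsPureExactSeq {R : Type u} [CommRing R] {N M L : Type u}
    [AddCommGroup N] [Module R N] [AddCommGroup M] [Module R M] [AddCommGroup L] [Module R L]
    (f : N →ₗ[R] M) (g : M →ₗ[R] L) : Prop extends IsShortExactSeq f g where
  tensor : ∀ (A : Type u) [AddCommGroup A] [Module R A],
    IsShortExactSeq (f.lTensor A) (g.lTensor A)

/-- `S`-pure exact sequences: pure exact, split over `R_S` after tensoring with `R_S`, and, for
every `s ∈ S`, split over `R/sR` after tensoring with `R/sR`. -/
structure IsSPureExactSeq {R : Type u} [CommRing R] (S : Submonoid R) {N M L : Type u}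
    [AddCommGroup N] [Module R N] [AddCommGroup M] [Module R M] [AddCommGroup L] [Module R L]
    (f : N →ₗ[R] M) (g : M →ₗ[R] L) : Prop extends IsPureExactSeq f g where
  split_localization :
    IsSplitExactSeq (f.baseChange (Localization S)) (g.baseChange (Localization S))
  split_quotient : ∀ s ∈ S,
    IsSplitExactSeq (f.baseChange (R ⧸ Ideal.span {s})) (g.baseChange (R ⧸ Ideal.span {s}))

/-- The class of `S`-pure injective modules: those injective with respect to all `S`-pure exact
sequences. -/
def sPInj {R : Type u} [CommRing R] (S : Submonoid R) : ObjectProperty (ModuleCat.{u} R) :=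
  fun E => ∀ (N M L : Type u) [AddCommGroup N] [Module R N] [AddCommGroup M] [Module R M]
    [AddCommGroup L] [Module R L] (f : N →ₗ[R] M) (g : M →ₗ[R] L), IsSPureExactSeq S f g →
    ∀ φ : N →ₗ[R] E, ∃ ψ : M →ₗ[R] E, ψ ∘ₗ f = φ

/-- The left `Ext¹`-orthogonal class of a class of `R`-modules. -/
def leftExtOrthogonal {R : Type u} [CommRing R] (𝒞 : ObjectProperty (ModuleCat.{u} R)) :
    ObjectProperty (ModuleCat.{u} R) :=
  fun M => ∀ C : ModuleCat.{u} R, 𝒞 C → Subsingleton (Abelian.Ext M C 1)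

/-- The class of `S`-weakly cotorsion modules: `Ext¹(R_S, C) = 0`. -/
def sWC {R : Type u} [CommRing R] (S : Submonoid R) : ObjectProperty (ModuleCat.{u} R) :=
  fun C => Subsingleton (Abelian.Ext (ModuleCat.of R (Localization S)) C 1)

/-- The class of `S`-strongly flat modules. -/
def sSF {R : Type u} [CommRing R] (S : Submonoid R) : ObjectProperty (ModuleCat.{u} R) :=
  leftExtOrthogonal (sWC S)

/-- The condition (OC) for the pair `(R, S)`: the projective dimension of `R_S` over `R` is at
most `1`, and a flat module `F` is `S`-strongly flat if and only if `F_S = R_S ⊗ F` is projective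
over `R_S` and, for every `s ∈ S`, `F/sF = R/sR ⊗ F` is projective over `R/sR`. -/
structure SatisfiesOC {R : Type u} [CommRing R] (S : Submonoid R) : Prop where
  projectiveDimension_le :
    projectiveDimension (ModuleCat.of R (Localization S)) ≤ 1
  sSF_iff : ∀ F : ModuleCat.{u} R, Module.Flat R F →
    (sSF S F ↔
      Module.Projective (Localization S) (Localization S ⊗[R] F) ∧
      ∀ s ∈ S, Module.Projective (R ⧸ Ideal.span {s}) ((R ⧸ Ideal.span {s}) ⊗[R] F))

/-! Under (OC), strong flatness of a flat module is tested by projectivity over `R_S` and over each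
`R/sR`. If `M` is `S`-strongly flat, a free presentation of it is therefore `S`-pure exact, so
`Ext¹(M, E) = 0` for every `S`-pure injective `E`. Conversely, `S-PInj` contains enough test
modules: character modules force `M` to be flat, while modules over `R_S` or `R/sR` force the
corresponding base change of `M` to be projective. -/

open Abelian

namespace IsShortExactSeq

variable {R : Type u} [CommRing R] {N M L : Type u}
    [AddCommGroup N] [Module R N] [AddCommGroup M] [Module R M] [AddCommGroup L] [Module R L]
    {f : N →ₗ[R] M} {g : M →ₗ[R] L}

/-- The short complex of a short exact sequence of modules. -/
abbrev shortComplex (h : IsShortExactSeq f g) : ShortComplex (ModuleCat.{u} R) :=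
  ModuleCat.shortComplexOfCompEqZero f g h.exact.linearMap_comp_eq_zero

theorem shortExact (h : IsShortExactSeq f g) : h.shortComplex.ShortExact :=
  ModuleCat.shortComplex_shortExact _ h.exact h.injective h.surjective

/-- If `Ext¹(L, C) = 0`, then maps `N → C` extend along short exact `0 → N → M → L → 0`. -/
theorem exists_extension (h : IsShortExactSeq f g) {C : Type u} [AddCommGroup C] [Module R C]
    [Subsingleton (Ext (ModuleCat.of R L) (ModuleCat.of R C) 1)] (φ : N →ₗ[R] C) :
    ∃ ψ : M →ₗ[R] C, ψ ∘ₗ f = φ := by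
  obtain ⟨x, hx⟩ := Ext.contravariant_sequence_exact₁ h.shortExact (ModuleCat.of R C)
    (Ext.mk₀ (ModuleCat.ofHom φ)) (add_zero 1) (Subsingleton.elim (α := Ext _ _ 1) _ _)
  obtain ⟨ψ, rfl⟩ := Ext.homEquiv₀.symm.surjective x
  rw [Ext.homEquiv₀_symm_apply, Ext.mk₀_comp_mk₀] at hx
  exact ⟨ψ.hom, congrArg ModuleCat.Hom.hom ((Ext.mk₀_bijective _ _).1 hx)⟩

/-- If `Ext¹(C, N) = 0`, then maps `C → L` lift along short exact `0 → N → M → L → 0`. -/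
theorem exists_lift (h : IsShortExactSeq f g) {C : Type u} [AddCommGroup C] [Module R C]
    [Subsingleton (Ext (ModuleCat.of R C) (ModuleCat.of R N) 1)] (φ : C →ₗ[R] L) :
    ∃ ψ : C →ₗ[R] M, g ∘ₗ ψ = φ := by
  obtain ⟨x, hx⟩ := Ext.covariant_sequence_exact₃ (ModuleCat.of R C) h.shortExact
    (Ext.mk₀ (ModuleCat.ofHom φ)) (zero_add 1) (Subsingleton.elim (α := Ext _ _ 1) _ _)
  obtain ⟨ψ, rfl⟩ := Ext.homEquiv₀.symm.surjective x
  rw [Ext.homEquiv₀_symm_apply, Ext.mk₀_comp_mk₀] at hx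
  exact ⟨ψ.hom, congrArg ModuleCat.Hom.hom ((Ext.mk₀_bijective _ _).1 hx)⟩

/-- If `M` is projective and all maps `N → C` extend along short exact `0 → N → M → L → 0`,
then `Ext¹(L, C) = 0`. -/
theorem subsingleton_ext [Module.Projective R M] (h : IsShortExactSeq f g)
    {C : Type u} [AddCommGroup C] [Module R C]
    (H : ∀ φ : N →ₗ[R] C, ∃ ψ : M →ₗ[R] C, ψ ∘ₗ f = φ) :
    Subsingleton (Ext (ModuleCat.of R L) (ModuleCat.of R C) 1) := by
  have : CategoryTheory.Projective (ModuleCat.of R M) :=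
    (IsProjective.iff_projective M).1 inferInstance
  refine subsingleton_of_forall_eq 0 fun x ↦ ?_
  -- Since `Ext¹(M, C) = 0`, the class `x` is the image of some `φ : N → C` under the connecting
  -- map, which kills every `φ` that factors through `f`.
  obtain ⟨y, rfl⟩ := Ext.contravariant_sequence_exact₃ h.shortExact (ModuleCat.of R C) x
    (Ext.eq_zero_of_projective (P := ModuleCat.of R M) _) (add_zero 1)
  obtain ⟨φ, rfl⟩ := Ext.homEquiv₀.symm.surjective y
  obtain ⟨ψ, hψ⟩ := H φ.hom
  have : φ = h.shortComplex.f ≫ ModuleCat.ofHom ψ := ModuleCat.hom_ext hψ.symm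
  rw [this, Ext.homEquiv₀_symm_apply, ← Ext.mk₀_comp_mk₀]
  exact h.shortExact.extClass_comp_assoc _

theorem isPureExactSeq [Module.Flat R L] (h : IsShortExactSeq f g) : IsPureExactSeq f g :=
  { h with
    tensor := fun A _ _ ↦
      ⟨LinearMap.lTensor_injective_of_exact_of_flat g h.surjective f h.injective h.exact A,
        lTensor_exact A h.exact h.surjective, LinearMap.lTensor_surjective A h.surjective⟩ }

/-- A short exact sequence with flat last term whose base change has projective last term splits
after that base change. -/
theorem isSplitExactSeq_baseChange [Module.Flat R L] (h : IsShortExactSeq f g)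
    (B : Type u) [CommRing B] [Algebra R B] [Module.Projective B (B ⊗[R] L)] :
    IsSplitExactSeq (f.baseChange B) (g.baseChange B) :=
  have hB := h.isPureExactSeq.tensor B
  { injective := hB.injective
    exact := hB.exact
    surjective := hB.surjective
    split := Module.projective_lifting_property (g.baseChange B) LinearMap.id hB.surjective }

/-- A short exact sequence is `S`-pure exact if its last term `L` is flat, `L_S` is projective over
`R_S`, and `L/sL` is projective over `R/sR` for every `s ∈ S`. -/
theorem isSPureExactSeq [Module.Flat R L] (h : IsShortExactSeq f g) (S : Submonoid R)
    (hloc : Module.Projective (Localization S) (Localization S ⊗[R] L))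
    (hquot : ∀ s ∈ S, Module.Projective (R ⧸ Ideal.span {s}) ((R ⧸ Ideal.span {s}) ⊗[R] L)) :
    IsSPureExactSeq S f g where
  toIsPureExactSeq := h.isPureExactSeq
  split_localization := h.isSplitExactSeq_baseChange (Localization S)
  split_quotient s hs :=
    have := hquot s hs
    h.isSplitExactSeq_baseChange (R ⧸ Ideal.span {s})

end IsShortExactSeq

variable {R : Type u} [CommRing R]

/-- The short exact sequence formed by a surjective linear map and its kernel. -/
theorem isShortExactSeq_ker {P M : Type u} [AddCommGroup P] [Module R P] [AddCommGroup M]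
    [Module R M] {g : P →ₗ[R] M} (hg : Function.Surjective g) :
    IsShortExactSeq (LinearMap.ker g).subtype g :=
  ⟨Submodule.subtype_injective _, LinearMap.exact_subtype_ker_map _, hg⟩

/-- Character modules are injective with respect to pure exact sequences. -/
theorem IsPureExactSeq.exists_extension_characterModule {N M L : Type u}
    [AddCommGroup N] [Module R N] [AddCommGroup M] [Module R M] [AddCommGroup L] [Module R L]
    {f : N →ₗ[R] M} {g : M →ₗ[R] L} (h : IsPureExactSeq f g)
    (A : Type u) [AddCommGroup A] [Module R A] (φ : N →ₗ[R] CharacterModule A) :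
    ∃ ψ : M →ₗ[R] CharacterModule A, ψ ∘ₗ f = φ :=
  -- By adjunction, maps into the character module of `A` are characters of the tensor product with
  -- `A`.
  rTensor_injective_iff_lcomp_surjective.1
    ((LinearMap.lTensor_inj_iff_rTensor_inj _ _).1 (h.tensor A).injective) φ

/-- Flat modules are left `Ext¹`-orthogonal to character modules. -/
theorem subsingleton_ext_characterModule (F : Type u) [AddCommGroup F] [Module R F]
    [Module.Flat R F] (A : Type u) [AddCommGroup A] [Module R A] :
    Subsingleton (Ext (ModuleCat.of R F) (ModuleCat.of R (CharacterModule A)) 1) :=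
  have h := isShortExactSeq_ker (Finsupp.linearCombination_id_surjective R F)
  h.subsingleton_ext (h.isPureExactSeq.exists_extension_characterModule A)

/-- The character module functor is exact. -/
theorem IsShortExactSeq.characterModule_dual {N M L : Type u}
    [AddCommGroup N] [Module R N] [AddCommGroup M] [Module R M] [AddCommGroup L] [Module R L]
    {f : N →ₗ[R] M} {g : M →ₗ[R] L} (h : IsShortExactSeq f g) :
    IsShortExactSeq (CharacterModule.dual g) (CharacterModule.dual f) where
  injective := CharacterModule.dual_injective_of_surjective g h.surjective
  surjective := CharacterModule.dual_surjective_of_injective f h.injective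
  exact c := by
    constructor
    · intro hc
      have hker (x : M) (hx : g x = 0) : c x = 0 := by
        obtain ⟨y, rfl⟩ := (h.exact x).1 hx
        exact DFunLike.congr_fun hc y
      refine ⟨g.toAddMonoidHom.liftOfSurjective h.surjective ⟨c, fun x hx ↦ hker x hx⟩, ?_⟩
      ext x
      exact AddMonoidHom.liftOfRightInverse_comp_apply g.toAddMonoidHom _
        (Function.rightInverse_surjInv h.surjective) ⟨c, fun x hx ↦ hker x hx⟩ x
    · rintro ⟨d, rfl⟩
      ext x
      exact (congrArg d (h.exact.apply_apply_eq_zero x)).trans (map_zero d)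

/-- A module that is left `Ext¹`-orthogonal to all character modules is flat. -/
theorem Module.Flat.of_subsingleton_ext_characterModule (M : Type u) [AddCommGroup M] [Module R M]
    (H : ∀ (A : Type u) [AddCommGroup A] [Module R A],
      Subsingleton (Ext (ModuleCat.of R M) (ModuleCat.of R (CharacterModule A)) 1)) :
    Module.Flat R M := by
  refine Module.Flat.iff_lTensor_injective'.2 fun I ↦ ?_
  have h : IsShortExactSeq I.subtype I.mkQ :=
    ⟨I.subtype_injective, LinearMap.exact_subtype_mkQ I, I.mkQ_surjective⟩
  -- By adjunction, extending a character of `M ⊗ I` to `M ⊗ R` means lifting a map `M → I*` along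
  -- `R* → I*`. The kernel of `R* → I*` is the character module of `R/I`, so the lift exists.
  refine CharacterModule.dual_surjective_iff_injective.1 fun c ↦ ?_
  obtain ⟨ψ, hψ⟩ := h.characterModule_dual.exists_lift (CharacterModule.curry c)
  refine ⟨CharacterModule.uncurry ψ, CharacterModule.homEquiv.symm.injective ?_⟩
  ext m i
  exact DFunLike.congr_fun (LinearMap.congr_fun hψ m) i

/-- A flat module `M` with `Ext¹_R(M, X) = 0` for all modules `X` over an `R`-algebra `B` has
projective base change to `B`. -/
theorem Module.Projective.baseChange_of_subsingleton_ext (B : Type u) [CommRing B] [Algebra R B]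
    (M : Type u) [AddCommGroup M] [Module R M] [Module.Flat R M]
    (H : ∀ (X : Type u) [AddCommGroup X] [Module R X] [Module B X] [IsScalarTower R B X],
      Subsingleton (Ext (ModuleCat.of R M) (ModuleCat.of R X) 1)) :
    Module.Projective B (B ⊗[R] M) := by
  have h := isShortExactSeq_ker (Finsupp.linearCombination_id_surjective R M)
  set g := Finsupp.linearCombination R (id : M → M)
  have hB := h.isPureExactSeq.tensor B
  -- The test module is `X = B ⊗ ker g`: extending `k ↦ 1 ⊗ k` to the free module yields a
  -- `B`-linear retraction, making `B ⊗ M` a direct summand of a free `B`-module.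
  obtain ⟨ψ, hψ⟩ := h.exists_extension (TensorProduct.mk R B (LinearMap.ker g) 1)
  have hret : ψ.liftBaseChange B ∘ₗ (LinearMap.ker g).subtype.baseChange B = LinearMap.id := by
    ext x
    simpa using LinearMap.congr_fun hψ x
  have hex : Function.Exact ((LinearMap.ker g).subtype.baseChange B) (g.baseChange B) := hB.exact
  have hsplit := (hex.split_tfae hB.injective hB.surjective).out 0 1
  obtain ⟨σ, hσ⟩ := hsplit.2 ⟨_, hret⟩
  exact Module.Projective.of_split σ (g.baseChange B) hσ

/-- Maps into modules over an `R`-algebra `B` extend along sequences that split over `B`. -/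
theorem IsSplitExactSeq.exists_extension_of_baseChange {N M L : Type u}
    [AddCommGroup N] [Module R N] [AddCommGroup M] [Module R M] [AddCommGroup L] [Module R L]
    {f : N →ₗ[R] M} {g : M →ₗ[R] L} (B : Type u) [CommRing B] [Algebra R B]
    (h : IsSplitExactSeq (f.baseChange B) (g.baseChange B))
    {X : Type u} [AddCommGroup X] [Module R X] [Module B X] [IsScalarTower R B X]
    (φ : N →ₗ[R] X) : ∃ ψ : M →ₗ[R] X, ψ ∘ₗ f = φ := by
  obtain ⟨r, hr⟩ := ((h.exact.split_tfae h.injective h.surjective).out 0 1).1 h.split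
  refine ⟨((φ.liftBaseChange B ∘ₗ r).restrictScalars R) ∘ₗ TensorProduct.mk R B M 1, ?_⟩
  ext x
  have : r (1 ⊗ₜ f x) = 1 ⊗ₜ x := LinearMap.congr_fun hr (1 ⊗ₜ x)
  simp [this]

theorem sPInj_characterModule (S : Submonoid R) (A : Type u) [AddCommGroup A] [Module R A] :
    sPInj S (ModuleCat.of R (CharacterModule A)) :=
  fun _ _ _ _ _ _ _ _ _ _ _ h φ ↦ h.toIsPureExactSeq.exists_extension_characterModule A φ

theorem sPInj_of_localization (S : Submonoid R) (X : Type u) [AddCommGroup X] [Module R X]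
    [Module (Localization S) X] [IsScalarTower R (Localization S) X] :
    sPInj S (ModuleCat.of R X) :=
  fun _ _ _ _ _ _ _ _ _ _ _ h φ ↦
    h.split_localization.exists_extension_of_baseChange (Localization S) φ

theorem sPInj_of_quotient (S : Submonoid R) {s : R} (hs : s ∈ S) (X : Type u) [AddCommGroup X]
    [Module R X] [Module (R ⧸ Ideal.span {s}) X] [IsScalarTower R (R ⧸ Ideal.span {s}) X] :
    sPInj S (ModuleCat.of R X) :=
  fun _ _ _ _ _ _ _ _ _ _ _ h φ ↦
    (h.split_quotient s hs).exists_extension_of_baseChange (R ⧸ Ideal.span {s}) φ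

/-- `S`-strongly flat modules are flat. -/
theorem flat_of_sSF (S : Submonoid R) {M : ModuleCat.{u} R} (hM : sSF S M) : Module.Flat R M :=
  .of_subsingleton_ext_characterModule M fun A _ _ ↦
    -- Flatness of `R_S` makes every character module `S`-weakly cotorsion.
    have : Module.Flat R (Localization S) := IsLocalization.flat _ S
    hM _ (subsingleton_ext_characterModule (Localization S) A)

theorem mainTheorem10 {R : Type u} [CommRing R] (S : Submonoid R) (hOC : SatisfiesOC S) :
    sSF S = leftExtOrthogonal (sPInj S) := by
  ext M
  constructor
  · intro hM E hE
    have := flat_of_sSF S hM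
    obtain ⟨hloc, hquot⟩ := (hOC.sSF_iff M this).1 hM
    have h := isShortExactSeq_ker (Finsupp.linearCombination_id_surjective R M)
    exact h.subsingleton_ext (hE _ _ _ _ _ (h.isSPureExactSeq S hloc hquot))
  · intro hM
    have : Module.Flat R M := .of_subsingleton_ext_characterModule M fun A _ _ ↦
      hM _ (sPInj_characterModule S A)
    refine (hOC.sSF_iff M this).2 ⟨?_, fun s hs ↦ ?_⟩
    · exact .baseChange_of_subsingleton_ext _ M fun X _ _ _ _ ↦ hM _ (sPInj_of_localization S X)
    · exact .baseChange_of_subsingleton_ext _ M fun X _ _ _ _ ↦ hM _ (sPInj_of_quotient S hs X)
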